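/- Let $0\le p\le 1$. Alice sends a message $u$, uniformly distributed over a set of $2^{Rn}$ messages (rounded up to an integer), by a deterministic encoder $u\mapsto \mathbf x(u)=(x_1,\dots,x_n)\in\{0,1\}^n$ over a binary channel controlled by a causal (online) adversary. The adversary has jamming random variables $J_1,\dots,J_n$ with an arbitrary joint law, independent of the message, and jamming functions $g_i$ with values in $\{0,1\}$; Bob receives $y_i=x_i\oplus g_i(x_1,\dots,x_i,J_1,\dots,J_i)$, where always $\sum_{i=1}^n g_i\le pn$. Bob decodes $\mathbf y$ by a fixed, possibly randomized, decoder, whose randomness is independent of the message and of the adversary's. The encoder and the decoder form an $(n,Rn)$-code; its error probability against a given adversary is the probability, averaged over all messages, that the decoded message differs from the sent one. A rate $R\ge 0$ is weakly achievable if for all $\varepsilon,\delta>0$ and all sufficiently large $n$ there is an $(n,(R-\delta)n)$-code whose error probability against every such adversary is at most $\varepsilon$. It is strongly achievable if for every $\delta>0$ there is $\alpha>0$ such that for all sufficiently large $n$ there is an $(n,(R-\delta)n)$-code whose error probability against every such adversary is at most $e^{-\alpha n}$. Let $C^{w}$ and $C^{s}$ be the suprema of the weakly and of the strongly achievable rates,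 let $H(p)=-p\log_2 p-(1-p)\log_2(1-p)$ (with $0\log_2 0=0$), and let $a^+=\max\{a,0\}$. Then $$C^{s}\le C^{w}\le \min\{\,1-H(p),\ (1-4p)^+\,\}.$$ Moreover, for every $R>(1-4p)^+$ there is a constant $c>0$, depending only on $p$ and $R$, such that for all sufficiently large $n$ and every $(n,Rn)$-code there is such an adversary against which the error probability of the code is at least $c$. -/

import Mathlib

open Filter MeasureTheory
open scoped ENNReal

/-- A code of block length `n` with `M` equiprobable messages: a deterministic encoder together with
a (possibly randomized) decoder. -/
structure DetCode (n M : ℕ) where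
  /-- Alice's deterministic encoder. -/
  enc : Fin M → (Fin n → Bool)
  /-- Bob's decoder: the law of the decoded message, given the received word. -/
  dec : (Fin n → Bool) → PMF (Fin M)

/-- An `(n, R n)` code: the number of messages is `2 ^ (R n)`, rounded up to an integer. -/
abbrev DetCodeOfRate (n : ℕ) (R : ℝ) : Type :=
  DetCode n ⌈(2 : ℝ) ^ (R * (n : ℝ))⌉₊

/-- A causal adversary who flips at most `p n` of the `n` transmitted bits. -/
structure CausalAdversary (n : ℕ) (p : ℝ) where
  /-- The value spaces of the jamming random variables `J i`. -/
  J : Fin n → Type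
  /-- The measurable structures on these spaces. -/
  mJ : ∀ i, MeasurableSpace (J i)
  /-- The joint law of the jamming random variables (they need not be independent). -/
  law : Measure (∀ i, J i)
  /-- The joint law is a probability measure. -/
  isProb : IsProbabilityMeasure law
  /-- The jamming functions: the `i`-th one sees the bits `x j` and the variables `J j`, `j ≤ i`. -/
  g : ∀ i : Fin n, ({j : Fin n // j ≤ i} → Bool) → (∀ j : {j : Fin n // j ≤ i}, J j.1) → Bool
  /-- The jamming functions are measurable in the jamming variables. -/
  measurable_g : ∀ i x, Measurable (g i x)
  /-- Power constraint, for all transmitted words and all values of the jamming variables. -/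
  power : ∀ (x : Fin n → Bool) (w : ∀ i, J i),
    (((Finset.univ.filter fun i : Fin n =>
      g i (fun j => x j.1) (fun j => w j.1) = true).card : ℕ) : ℝ) ≤ p * (n : ℝ)

attribute [instance] CausalAdversary.mJ CausalAdversary.isProb

namespace CausalAdversary

/-- The channel output `y i = x i ⊕ g i (x^i, J^i)`. -/
def output {n : ℕ} {p : ℝ} (A : CausalAdversary n p) (x : Fin n → Bool) (w : ∀ i, A.J i) :
    Fin n → Bool :=
  fun i => xor (x i) (A.g i (fun j => x j.1) (fun j => w j.1))

end CausalAdversary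

namespace DetCode

/-- Probability, over the adversary's and the decoder's (independent) randomness, that the decoded
message differs from the encoded message `u`. -/
noncomputable def errorProbOf {n M : ℕ} {p : ℝ} (C : DetCode n M) (A : CausalAdversary n p)
    (u : Fin M) : ℝ≥0∞ :=
  ∫⁻ w, (C.dec (A.output (C.enc u) w)).toMeasure {u' | u' ≠ u} ∂A.law

/-- The probability of error of the code against the adversary `A`: the average over all messages. -/
noncomputable def errorProb {n M : ℕ} {p : ℝ} (C : DetCode n M) (A : CausalAdversary n p) : ℝ≥0∞ :=
  (∑ u, C.errorProbOf A u) / (M : ℝ≥0∞)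

end DetCode

/-- Weak achievability by deterministic codes against causal adversaries of power `p n`. -/
def WeaklyAchievable (p R : ℝ) : Prop :=
  ∀ ε : ℝ, 0 < ε → ∀ δ : ℝ, 0 < δ → ∀ᶠ n : ℕ in atTop,
    ∃ C : DetCodeOfRate n (R - δ), ∀ A : CausalAdversary n p,
      C.errorProb A ≤ ENNReal.ofReal ε

/-- Strong achievability: the error probability decays exponentially in the block length. -/
def StronglyAchievable (p R : ℝ) : Prop :=
  ∀ δ : ℝ, 0 < δ → ∃ α : ℝ, 0 < α ∧ ∀ᶠ n : ℕ in atTop,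
    ∃ C : DetCodeOfRate n (R - δ), ∀ A : CausalAdversary n p,
      C.errorProb A ≤ ENNReal.ofReal (Real.exp (-α * (n : ℝ)))

/-- The weak capacity: supremum of the weakly achievable rates `R ≥ 0`, in the extended reals. -/
noncomputable def weakCapacity (p : ℝ) : EReal :=
  ⨆ (R : ℝ) (_ : 0 ≤ R ∧ WeaklyAchievable p R), (R : EReal)

/-- The strong capacity: supremum of the strongly achievable rates `R ≥ 0`. -/
noncomputable def strongCapacity (p : ℝ) : EReal :=
  ⨆ (R : ℝ) (_ : 0 ≤ R ∧ StronglyAchievable p R), (R : EReal)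

/-- The binary entropy function in bits. -/
noncomputable def binaryEntropyBits (p : ℝ) : ℝ := Real.binEntropy p / Real.log 2

/-! Two deterministic attacks give the two bounds.

For `(1 - 4p)⁺`, take `R'` strictly between this bound and `R`. The adversary waits for `ℓ = ⌈R' n⌉`
bits. There are far fewer than `M` prefixes, so a typical codeword shares its prefix with many
others, and by Plotkin's bound two such codewords differ on average in at most `(n - ℓ)/2` places,
which is about `pn` or less by a fixed margin below `2pn`. For each prefix a target is fixed, and
the sent word is moved half way to it by flipping alternate differences. `xor_mixFlips_comm` shows
that sending `x` with target `x'` and sending `x'` with target `x` give the same output, so the two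
error probabilities add up to at least 1 (`one_le_add_error`). Averaging over targets in the class
yields a good one (`exists_target`), and `exists_adversary_push` joins the prefixes.

For `1 - H(p)`, a fixed error word of weight `k = ⌊pn⌋` suffices (`exists_adversary_noise`): over
all such error words and all messages the success probabilities sum to at most `2 ^ n`, while
`exp_binEntropy_le_choose` bounds the number of error words from below. -/

/-! ### Deterministic adversaries and decoding probabilities. -/

namespace CausalAdversary

/-- The deterministic adversary given by a flipping rule `f` in which the decision on bit `i` depends
on the bits up to `i` only. -/
noncomputable def ofFlips {n : ℕ} {p : ℝ} (f : (Fin n → Bool) → Fin n → Bool)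
    (causal : ∀ x x' i, (∀ j ≤ i, x j = x' j) → f x i = f x' i)
    (power : ∀ x, (((Finset.univ.filter fun i => f x i = true).card : ℕ) : ℝ) ≤ p * (n : ℝ)) :
    CausalAdversary n p where
  J _ := Unit
  mJ _ := inferInstance
  law := Measure.dirac fun _ => ()
  isProb := inferInstance
  -- The padding of the unseen bits is immaterial by `causal`.
  g i z _ := f (fun j => if h : j ≤ i then z ⟨j, h⟩ else false) i
  measurable_g _ _ := measurable_const
  power x _ := by
    convert power x using 5 with i
    rw [causal _ x i]
    intro j hj
    simp [hj]

theorem output_ofFlips {n : ℕ} {p : ℝ} (f : (Fin n → Bool) → Fin n → Bool) (causal)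
    (power) (x : Fin n → Bool) (w) :
    (ofFlips (p := p) f causal power).output x w = fun i => xor (x i) (f x i) := by
  funext i
  change xor (x i) (f _ i) = _
  rw [causal _ x i]
  intro j hj
  simp [hj]

end CausalAdversary

namespace DetCode

/-- The probability of decoding the received word `y` to the message `u`. -/
noncomputable def decProb {n M : ℕ} (C : DetCode n M) (y : Fin n → Bool) (u : Fin M) : ℝ :=
  (C.dec y u).toReal

theorem decProb_nonneg {n M : ℕ} (C : DetCode n M) (y : Fin n → Bool) (u : Fin M) :
    0 ≤ C.decProb y u := ENNReal.toReal_nonneg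

theorem sum_decProb {n M : ℕ} (C : DetCode n M) (y : Fin n → Bool) :
    ∑ u, C.decProb y u = 1 := by
  unfold decProb
  rw [← ENNReal.toReal_sum fun u _ => (C.dec y).apply_ne_top u, ← tsum_fintype (L := .unconditional _),
    (C.dec y).tsum_coe, ENNReal.toReal_one]

theorem decProb_le_one {n M : ℕ} (C : DetCode n M) (y : Fin n → Bool) (u : Fin M) :
    C.decProb y u ≤ 1 := by
  rw [← C.sum_decProb y]
  exact Finset.single_le_sum (fun v _ => C.decProb_nonneg y v) (Finset.mem_univ u)

theorem decProb_add_le_one {n M : ℕ} (C : DetCode n M) (y : Fin n → Bool) {u v : Fin M}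
    (h : u ≠ v) : C.decProb y u + C.decProb y v ≤ 1 := by
  rw [← C.sum_decProb y, ← Finset.sum_pair h]
  exact Finset.sum_le_sum_of_subset_of_nonneg (Finset.subset_univ _)
    fun w _ _ => C.decProb_nonneg y w

theorem toMeasure_ne {n M : ℕ} (C : DetCode n M) (y : Fin n → Bool) (u : Fin M) :
    (C.dec y).toMeasure {u' | u' ≠ u} = ENNReal.ofReal (1 - C.decProb y u) := by
  have h : {u' : Fin M | u' ≠ u} = {u}ᶜ := by ext; simp
  rw [h, prob_compl_eq_one_sub (measurableSet_singleton u),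
    PMF.toMeasure_apply_singleton _ _ (measurableSet_singleton u),
    ENNReal.ofReal_sub _ (C.decProb_nonneg y u), ENNReal.ofReal_one, decProb,
    ENNReal.ofReal_toReal ((C.dec y).apply_ne_top u)]

theorem errorProb_ofFlips {n M : ℕ} {p : ℝ} (C : DetCode n M) (f : (Fin n → Bool) → Fin n → Bool)
    (causal) (power) :
    C.errorProb (CausalAdversary.ofFlips (p := p) f causal power) =
      ENNReal.ofReal (∑ u, (1 - C.decProb (fun i => xor (C.enc u i) (f (C.enc u) i)) u)) /
        (M : ℝ≥0∞) := by
  unfold errorProb errorProbOf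
  rw [ENNReal.ofReal_sum_of_nonneg fun u _ => sub_nonneg.2 (C.decProb_le_one _ u)]
  congr 1
  refine Finset.sum_congr rfl fun u _ => ?_
  simp only [CausalAdversary.output_ofFlips, toMeasure_ne]
  rw [lintegral_const, measure_univ, mul_one]

/-- A lower bound on the sum of the errors gives one on the error probability. -/
theorem le_errorProb_ofFlips {n M : ℕ} {p c : ℝ} (C : DetCode n M)
    (f : (Fin n → Bool) → Fin n → Bool) (causal) (power) (hM : 0 < M)
    (h : c * M ≤ ∑ u, (1 - C.decProb (fun i => xor (C.enc u i) (f (C.enc u) i)) u)) :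
    ENNReal.ofReal c ≤ C.errorProb (CausalAdversary.ofFlips (p := p) f causal power) := by
  rw [errorProb_ofFlips, ENNReal.le_div_iff_mul_le (by simp [hM.ne']) (by simp),
    ← ENNReal.ofReal_natCast, ← ENNReal.ofReal_mul' (Nat.cast_nonneg M)]
  exact ENNReal.ofReal_le_ofReal h

end DetCode

/-! ### Enforcing the power constraint causally. -/

/-- The flips of `s`, stopped when the budget `p n` is exhausted. -/
noncomputable def truncate {n : ℕ} (p : ℝ) (s : Fin n → Bool) (i : Fin n) : Bool :=
  s i && decide (((Finset.univ.filter fun j => j ≤ i ∧ s j = true).card : ℝ) ≤ p * n)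

theorem truncate_congr {n : ℕ} (p : ℝ) {s t : Fin n → Bool} {i : Fin n}
    (h : ∀ j ≤ i, s j = t j) : truncate p s i = truncate p t i := by
  have : (Finset.univ.filter fun j => j ≤ i ∧ s j = true) =
      Finset.univ.filter fun j => j ≤ i ∧ t j = true := by
    ext j
    simp only [Finset.mem_filter, Finset.mem_univ, true_and]
    exact and_congr_right fun hj => by rw [h j hj]
  rw [truncate, truncate, this, h i le_rfl]

theorem card_truncate_le {n : ℕ} {p : ℝ} (hp : 0 ≤ p) (s : Fin n → Bool) :
    ((Finset.univ.filter fun i => truncate p s i = true).card : ℝ) ≤ p * n := by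
  set G := Finset.univ.filter fun i => truncate p s i = true with hG
  rcases G.eq_empty_or_nonempty with h | h
  · rw [h]
    simpa using by positivity
  · have hmem : ∀ j ∈ G, s j = true ∧
        ((Finset.univ.filter fun k => k ≤ j ∧ s k = true).card : ℝ) ≤ p * n := by
      simp [hG, truncate]
    -- The last surviving flip passed the budget test, and its count includes all the surviving
    -- flips.
    refine le_trans ?_ (hmem _ (G.max'_mem h)).2
    norm_cast
    refine Finset.card_le_card fun j hj => ?_
    simpa using ⟨G.le_max' j hj, (hmem j hj).1⟩

theorem truncate_eq_self {n : ℕ} {p : ℝ} {s : Fin n → Bool}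
    (h : ((Finset.univ.filter fun i => s i = true).card : ℝ) ≤ p * n) : truncate p s = s := by
  funext i
  have : ((Finset.univ.filter fun j => j ≤ i ∧ s j = true).card : ℝ) ≤ p * n := by
    refine le_trans ?_ h
    norm_cast
    exact Finset.card_le_card fun j hj => by simp_all
  simp [truncate, this]

/-! ### Moving a word half way towards another. -/

/-- At most half (rounded up) of the elements of a finite set have an even rank, and likewise for
odd ranks. -/
theorem card_filter_even_rank {α : Type*} [LinearOrder α] (D : Finset α) :
    (D.filter fun i => Even (D.filter fun j => j < i).card).card = (D.card + 1) / 2 ∧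
    (D.filter fun i => ¬ Even (D.filter fun j => j < i).card).card = D.card / 2 := by
  have key : (D.filter fun i => Even (D.filter fun j => j < i).card).card = (D.card + 1) / 2 := by
    induction D using Finset.induction_on_max with
    | empty => simp
    | insert a s ha ih =>
      have has : a ∉ s := fun h => lt_irrefl _ (ha a h)
      have h1 : ((insert a s).filter fun j => j < a) = s := by
        ext j
        simp only [Finset.mem_filter, Finset.mem_insert]
        constructor
        · rintro ⟨rfl | h, h'⟩
          · exact absurd h' (lt_irrefl _)
          · exact h
        · exact fun h => ⟨Or.inr h, ha j h⟩
      have h2 : (s.filter fun i => Even ((insert a s).filter fun j => j < i).card) =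
          s.filter fun i => Even (s.filter fun j => j < i).card := by
        refine Finset.filter_congr fun i hi => ?_
        rw [Finset.filter_insert, if_neg (ha i hi).not_gt]
      rw [Finset.filter_insert, h1, h2, Finset.card_insert_of_notMem has]
      split_ifs with he
      · rw [Finset.card_insert_of_notMem (by simp [has]), ih]
        obtain ⟨r, hr⟩ := he
        omega
      · rw [ih]
        rw [Nat.not_even_iff_odd] at he
        obtain ⟨r, hr⟩ := he
        omega
  refine ⟨key, ?_⟩
  have := Finset.card_filter_add_card_filter_not (s := D)
    (fun i => Even (D.filter fun j => j < i).card)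
  omega

/-- The positions where `x` and `x'` differ. -/
def diffSet {n : ℕ} (x x' : Fin n → Bool) : Finset (Fin n) :=
  Finset.univ.filter fun i => x i ≠ x' i

@[simp]
theorem mem_diffSet {n : ℕ} {x x' : Fin n → Bool} {i : Fin n} : i ∈ diffSet x x' ↔ x i ≠ x' i := by
  simp [diffSet]

/-- The first difference of `x` and `x'` occurs by time `i`, and there `x` has a one. -/
def leads {n : ℕ} (x x' : Fin n → Bool) (i : Fin n) : Prop :=
  ∃ j ≤ i, x j = true ∧ x' j = false ∧ ∀ k < j, x k = x' k

open Classical in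
/-- The rule that turns `x` into a word half way between `x` and `x'`: flip at every other
difference, where the value of `x` at the first difference decides which ones to flip. -/
noncomputable def mixFlips {n : ℕ} (x x' : Fin n → Bool) (i : Fin n) : Bool :=
  decide (x i ≠ x' i) &&
    xor (decide (leads x x' i)) (decide (Even ((diffSet x x').filter fun j => j < i).card))

theorem mixFlips_congr {n : ℕ} {x x' z z' : Fin n → Bool} {i : Fin n}
    (h : ∀ j ≤ i, x j = z j) (h' : ∀ j ≤ i, x' j = z' j) : mixFlips x x' i = mixFlips z z' i := by
  have h1 : leads x x' i ↔ leads z z' i := by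
    refine exists_congr fun j => and_congr_right fun hj => ?_
    rw [h j hj, h' j hj]
    refine and_congr_right fun _ => and_congr_right fun _ => forall₂_congr fun k hk => ?_
    rw [h k (hk.le.trans hj), h' k (hk.le.trans hj)]
  have h2 : ((diffSet x x').filter fun j => j < i) = (diffSet z z').filter fun j => j < i := by
    ext j
    simp only [diffSet, Finset.mem_filter, Finset.mem_univ, true_and, ne_eq]
    refine and_congr_left fun hj => ?_
    rw [h j hj.le, h' j hj.le]
  rw [mixFlips, mixFlips, h2, h i le_rfl, h' i le_rfl, decide_eq_decide.2 h1]

/-- The first difference is unique and no later than any other difference, so its bit `b = x m`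
settles `leads` at all differences, with opposite outcomes for the two orders of the words. This is
the causal tie-break between them. -/
theorem exists_leads {n : ℕ} (x x' : Fin n → Bool) :
    ∃ b : Bool, ∀ i, x i ≠ x' i → (leads x x' i ↔ b = true) ∧ (leads x' x i ↔ b = false) := by
  rcases (diffSet x x').eq_empty_or_nonempty with h | h
  · refine ⟨true, fun i hi => ?_⟩
    have : i ∈ diffSet x x' := mem_diffSet.2 hi
    simp [h] at this
  · set m := (diffSet x x').min' h with hm
    have hmem : x m ≠ x' m := mem_diffSet.1 ((diffSet x x').min'_mem h)
    have hlt : ∀ k < m, x k = x' k := by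
      intro k hk
      by_contra hne
      have : k ∈ diffSet x x' := mem_diffSet.2 hne
      exact absurd ((diffSet x x').min'_le k this) (not_le.2 hk)
    have huniq : ∀ j, x j ≠ x' j → (∀ k < j, x k = x' k) → j = m := by
      intro j hj hj'
      rcases lt_trichotomy j m with hlt' | rfl | hgt
      · exact absurd (hlt j hlt') hj
      · rfl
      · exact absurd (hj' m hgt) hmem
    refine ⟨x m, fun i hi => ?_⟩
    have hmi : m ≤ i := by
      by_contra hlt'
      exact hi (hlt i (not_le.1 hlt'))
    constructor
    · constructor
      · rintro ⟨j, -, h1, h2, h3⟩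
        rwa [← huniq j (by simp [h1, h2]) h3]
      · intro hx
        exact ⟨m, hmi, hx, by simpa [hx] using hmem, hlt⟩
    · constructor
      · rintro ⟨j, -, h1, h2, h3⟩
        rwa [← huniq j (by simp [h1, h2]) fun k hk => (h3 k hk).symm]
      · intro hx
        exact ⟨m, hmi, by simpa [hx] using hmem, hx, fun k hk => (hlt k hk).symm⟩

theorem diffSet_comm {n : ℕ} (x x' : Fin n → Bool) : diffSet x x' = diffSet x' x := by
  ext i
  simp [eq_comm]

/-- The mixture of two words does not tell which of them was sent. -/
theorem xor_mixFlips_comm {n : ℕ} (x x' : Fin n → Bool) (i : Fin n) :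
    xor (x i) (mixFlips x x' i) = xor (x' i) (mixFlips x' x i) := by
  obtain ⟨b, hb⟩ := exists_leads x x'
  by_cases h : x i = x' i
  · simp [mixFlips, h]
  · have hx : x' i = !x i := by
      cases h1 : x i <;> cases h2 : x' i <;> simp_all
    -- At a difference exactly one of the two rules flips, which makes the unequal bits equal.
    simp only [mixFlips, (hb i h).1, (hb i h).2, diffSet_comm x' x, hx]
    cases x i <;> cases b <;> simp

/-- All flips fall on differences whose ranks have the same parity: even if `b = false`, odd if `b =
true`. -/
theorem card_mixFlips_le {n : ℕ} (x x' : Fin n → Bool) :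
    (Finset.univ.filter fun i => mixFlips x x' i = true).card ≤ ((diffSet x x').card + 1) / 2 := by
  obtain ⟨b, hb⟩ := exists_leads x x'
  obtain ⟨he, ho⟩ := card_filter_even_rank (diffSet x x')
  cases b with
  | false =>
    rw [← he]
    refine Finset.card_le_card fun i hi => ?_
    simp only [Finset.mem_filter, Finset.mem_univ, true_and, mixFlips, Bool.and_eq_true,
      decide_eq_true_eq] at hi
    have := (hb i hi.1).1
    refine Finset.mem_filter.2 ⟨mem_diffSet.2 hi.1, ?_⟩
    simpa [this] using hi.2
  | true =>
    refine le_trans (b := (diffSet x x').card / 2) ?_ (by omega)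
    rw [← ho]
    refine Finset.card_le_card fun i hi => ?_
    simp only [Finset.mem_filter, Finset.mem_univ, true_and, mixFlips, Bool.and_eq_true,
      decide_eq_true_eq] at hi
    have := (hb i hi.1).1
    refine Finset.mem_filter.2 ⟨mem_diffSet.2 hi.1, ?_⟩
    simpa [this] using hi.2

/-! ### Plotkin's bound. -/

theorem card_diffSet {n : ℕ} (x x' : Fin n → Bool) :
    ((diffSet x x').card : ℝ) = ∑ i, if x i ≠ x' i then (1 : ℝ) else 0 := by
  rw [diffSet, Finset.sum_boole]

/-- With the bits coded as signs, the indicator is `(1 - s u * s v) / 2`, and the double sum of the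
products is a square. -/
theorem sum_sum_ne_le {ι : Type*} (S : Finset ι) (b : ι → Bool) :
    ∑ u ∈ S, ∑ v ∈ S, (if b u ≠ b v then (1 : ℝ) else 0) ≤ (S.card : ℝ) ^ 2 / 2 := by
  have h : ∀ u v, (if b u ≠ b v then (1 : ℝ) else 0) =
      (1 - (if b u then 1 else -1) * (if b v then 1 else -1)) / 2 := by
    intro u v
    cases b u <;> cases b v <;> norm_num
  simp only [h, ← Finset.sum_div, Finset.sum_sub_distrib, ← Finset.mul_sum, ← Finset.sum_mul,
    Finset.sum_const, nsmul_eq_mul, mul_one]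
  have := mul_self_nonneg (∑ u ∈ S, if b u then (1 : ℝ) else -1)
  linarith

/-- Plotkin's bound: the total distance of words that agree on the first `ℓ` bits. -/
theorem sum_sum_card_diffSet_le {n : ℕ} {ι : Type*} (S : Finset ι) (x : ι → Fin n → Bool) (ℓ : ℕ)
    (h : ∀ u ∈ S, ∀ v ∈ S, ∀ i : Fin n, (i : ℕ) < ℓ → x u i = x v i) :
    ∑ u ∈ S, ∑ v ∈ S, ((diffSet (x u) (x v)).card : ℝ) ≤
      (S.card : ℝ) ^ 2 / 2 * ((n - ℓ : ℕ) : ℝ) := by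
  simp only [card_diffSet]
  have hswap : ∑ u ∈ S, ∑ v ∈ S, ∑ i, (if x u i ≠ x v i then (1 : ℝ) else 0) =
      ∑ i, ∑ u ∈ S, ∑ v ∈ S, (if x u i ≠ x v i then (1 : ℝ) else 0) := by
    rw [Finset.sum_comm (s := Finset.univ)]
    exact Finset.sum_congr rfl fun u _ => Finset.sum_comm
  rw [hswap]
  calc _ ≤ ∑ i : Fin n, if ℓ ≤ (i : ℕ) then (S.card : ℝ) ^ 2 / 2 else 0 := by
        refine Finset.sum_le_sum fun i _ => ?_
        split_ifs with hi
        · exact sum_sum_ne_le S fun u => x u i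
        · refine (Finset.sum_eq_zero fun u hu => Finset.sum_eq_zero fun v hv => ?_).le
          rw [if_neg]
          simpa using h u hu v hv i (not_le.1 hi)
    _ = _ := by
        rw [Fin.sum_univ_eq_sum_range fun i => if ℓ ≤ i then (S.card : ℝ) ^ 2 / 2 else 0,
          ← Finset.sum_filter, Finset.sum_const, nsmul_eq_mul, mul_comm]
        congr 2
        rw [← Nat.card_Ico ℓ n]
        congr 1
        ext i
        simp [and_comm]

/-! ### The wait-and-push attack. -/

/-- The word that agrees with `x` on the first `ℓ` bits and with `w` afterwards. -/
def splice {n : ℕ} (ℓ : ℕ) (x w : Fin n → Bool) (i : Fin n) : Bool :=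
  if (i : ℕ) < ℓ then x i else w i

theorem splice_eq_right {n : ℕ} {ℓ : ℕ} {x w : Fin n → Bool}
    (h : ∀ i : Fin n, (i : ℕ) < ℓ → x i = w i) : splice ℓ x w = w := by
  funext i
  unfold splice
  split_ifs with hi
  exacts [h i hi, rfl]

/-- The received word when `x` is sent and the adversary pushes it towards `x'`. -/
noncomputable def pushed {n : ℕ} (p : ℝ) (x x' : Fin n → Bool) (i : Fin n) : Bool :=
  xor (x i) (truncate p (mixFlips x x') i)

namespace DetCode

/-- If `u = v` or the distance is at least `D`, the left side is at most 0. Otherwise the budget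
covers both attacks, and one received word cannot be decoded to both messages with total probability
above 1. -/
theorem one_le_add_error {n M : ℕ} (C : DetCode n M) {p D : ℝ} (hD : 0 < D)
    (hbudget : ∀ d : ℕ, (d : ℝ) < D → (((d + 1) / 2 : ℕ) : ℝ) ≤ p * n) (u v : Fin M) :
    1 - (if u = v then 1 else 0) - ((diffSet (C.enc u) (C.enc v)).card : ℝ) / D ≤
      (1 - C.decProb (pushed p (C.enc u) (C.enc v)) u) +
        (1 - C.decProb (pushed p (C.enc v) (C.enc u)) v) := by
  have h1 := C.decProb_le_one (pushed p (C.enc u) (C.enc v)) u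
  have h2 := C.decProb_le_one (pushed p (C.enc v) (C.enc u)) v
  have h3 : 0 ≤ ((diffSet (C.enc u) (C.enc v)).card : ℝ) / D := by positivity
  by_cases huv : u = v
  · simp only [huv, if_true] at *
    linarith
  · rw [if_neg huv]
    rcases lt_or_ge ((diffSet (C.enc u) (C.enc v)).card : ℝ) D with hlt | hge
    · have hle := hbudget _ hlt
      have hc1 := (Nat.cast_le (α := ℝ)).2 (card_mixFlips_le (C.enc u) (C.enc v))
      have hc2 := (Nat.cast_le (α := ℝ)).2 (card_mixFlips_le (C.enc v) (C.enc u))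
      rw [diffSet_comm] at hc2
      have heq : pushed p (C.enc u) (C.enc v) = pushed p (C.enc v) (C.enc u) := by
        funext i
        rw [pushed, pushed, truncate_eq_self (hc1.trans hle), truncate_eq_self (hc2.trans hle),
          xor_mixFlips_comm]
      have h4 := C.decProb_add_le_one (pushed p (C.enc v) (C.enc u)) huv
      rw [heq] at h1 ⊢
      linarith
    · have : 1 ≤ ((diffSet (C.enc u) (C.enc v)).card : ℝ) / D := (one_le_div hD).2 hge
      linarith

/-- Among the codewords with a given prefix there is one towards which the adversary can push so
that many of these codewords are decoded wrongly. -/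
theorem exists_target {n M : ℕ} (C : DetCode n M) {p D θ : ℝ} {ℓ : ℕ} (hD : 0 < D)
    (hbudget : ∀ d : ℕ, (d : ℝ) < D → (((d + 1) / 2 : ℕ) : ℝ) ≤ p * n)
    (hℓ : ((n - ℓ : ℕ) : ℝ) ≤ 2 * (1 - θ) * D) (S : Finset (Fin M))
    (hS : ∀ u ∈ S, ∀ v ∈ S, ∀ i : Fin n, (i : ℕ) < ℓ → C.enc u i = C.enc v i) :
    ∃ w : Fin n → Bool, (θ * S.card - 1) / 2 ≤
      ∑ u ∈ S, (1 - C.decProb (pushed p (C.enc u) (splice ℓ (C.enc u) w)) u) := by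
  rcases S.eq_empty_or_nonempty with rfl | hne
  · exact ⟨fun _ => false, by norm_num⟩
  -- Averaging: it is enough to try the codewords of `S` themselves as targets.
  by_contra! hcon
  set e : Fin M → Fin M → ℝ := fun u v => 1 - C.decProb (pushed p (C.enc u) (C.enc v)) u with he
  have h1 : ∑ v ∈ S, ∑ u ∈ S, e u v < ∑ v ∈ S, (θ * S.card - 1) / 2 := by
    refine Finset.sum_lt_sum_of_nonempty hne fun v hv => ?_
    refine lt_of_eq_of_lt (Finset.sum_congr rfl fun u hu => ?_) (hcon (C.enc v))
    rw [splice_eq_right (hS u hu v hv)]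
  have h2 : ∑ v ∈ S, ∑ u ∈ S, (1 - (if v = u then (1 : ℝ) else 0) -
      ((diffSet (C.enc v) (C.enc u)).card : ℝ) / D) ≤ ∑ v ∈ S, ∑ u ∈ S, (e v u + e u v) :=
    Finset.sum_le_sum fun v _ => Finset.sum_le_sum fun u _ => C.one_le_add_error hD hbudget v u
  have h3 := sum_sum_card_diffSet_le S C.enc ℓ hS
  have h4 : (S.card : ℝ) ^ 2 / 2 * ((n - ℓ : ℕ) : ℝ) / D ≤ (S.card : ℝ) ^ 2 * (1 - θ) := by
    rw [div_le_iff₀ hD]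
    nlinarith [mul_le_mul_of_nonneg_left hℓ (by positivity : 0 ≤ (S.card : ℝ) ^ 2 / 2)]
  have h5 := div_le_div_of_nonneg_right h3 hD.le
  have h6 : ∑ v ∈ S, ∑ u ∈ S, e v u = ∑ v ∈ S, ∑ u ∈ S, e u v := Finset.sum_comm
  have h7 : ∑ v ∈ S, ∑ u ∈ S, (if v = u then (1 : ℝ) else 0) = S.card := by
    rw [Finset.sum_congr rfl fun v hv => by rw [Finset.sum_ite_eq, if_pos hv]]
    simp
  simp only [Finset.sum_sub_distrib, Finset.sum_add_distrib, h6, h7, ← Finset.sum_div,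
    Finset.sum_const, nsmul_eq_mul, mul_one] at h1 h2
  nlinarith

/-- The first `ℓ` bits of a word. -/
def takeBits {n : ℕ} (ℓ : ℕ) (x : Fin n → Bool) (j : Fin ℓ) : Bool :=
  if h : (j : ℕ) < n then x ⟨j, h⟩ else false

theorem takeBits_eq_iff {n : ℕ} {ℓ : ℕ} {x x' : Fin n → Bool} :
    takeBits ℓ x = takeBits ℓ x' ↔ ∀ i : Fin n, (i : ℕ) < ℓ → x i = x' i := by
  constructor
  · intro h i hi
    simpa [takeBits] using congrFun h ⟨i, hi⟩
  · intro h
    funext j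
    unfold takeBits
    split_ifs with hj
    exacts [h ⟨j, hj⟩ j.2, rfl]

/-- The wait-and-push attack on a code with `M` codewords: wait for `ℓ` bits, then push towards a
codeword with the same prefix. -/
theorem exists_adversary_push {n M : ℕ} (C : DetCode n M) {p D θ c : ℝ} {ℓ : ℕ} (hp : 0 ≤ p)
    (hM : 0 < M) (hD : 0 < D)
    (hbudget : ∀ d : ℕ, (d : ℝ) < D → (((d + 1) / 2 : ℕ) : ℝ) ≤ p * n)
    (hℓ : ((n - ℓ : ℕ) : ℝ) ≤ 2 * (1 - θ) * D) (hc : c * M ≤ (θ * M - 2 ^ ℓ) / 2) :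
    ∃ A : CausalAdversary n p, ENNReal.ofReal c ≤ C.errorProb A := by
  have key : ∀ v : Fin ℓ → Bool, ∃ w : Fin n → Bool,
      (θ * (Finset.univ.filter fun u => takeBits ℓ (C.enc u) = v).card - 1) / 2 ≤
      ∑ u with takeBits ℓ (C.enc u) = v,
        (1 - C.decProb (pushed p (C.enc u) (splice ℓ (C.enc u) w)) u) := by
    refine fun v => C.exists_target hD hbudget hℓ _ fun u hu u' hu' => takeBits_eq_iff.1 ?_
    simp only [Finset.mem_filter, Finset.mem_univ, true_and] at hu hu'
    rw [hu, hu']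
  choose w hw using key
  refine ⟨_, C.le_errorProb_ofFlips
    (fun x => truncate p (mixFlips x (splice ℓ x (w (takeBits ℓ x))))) ?_
    (fun x => card_truncate_le hp _) hM ?_⟩
  · intro x x' i h
    refine truncate_congr p fun j hj => ?_
    -- Before time `ℓ` the target coincides with `x`, so the unknown rest of the prefix has no
    -- influence; from then on the prefix is known.
    rcases lt_or_ge (j : ℕ) ℓ with hjℓ | hjℓ
    · refine mixFlips_congr (fun k hk => h k (hk.trans hj)) fun k hk => ?_
      have : (k : ℕ) < ℓ := lt_of_le_of_lt hk hjℓ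
      simp [splice, this, h k (hk.trans hj)]
    · have : takeBits ℓ x = takeBits ℓ x' :=
        takeBits_eq_iff.2 fun k hk => h k (le_trans (Fin.le_def.2 (hk.le.trans hjℓ)) hj)
      rw [this]
      refine mixFlips_congr (fun k hk => h k (hk.trans hj)) fun k hk => ?_
      simp [splice, h k (hk.trans hj)]
  · refine hc.trans ?_
    change _ ≤ ∑ u, (1 - C.decProb
      (pushed p (C.enc u) (splice ℓ (C.enc u) (w (takeBits ℓ (C.enc u))))) u)
    rw [← Finset.sum_fiberwise Finset.univ fun u => takeBits ℓ (C.enc u)]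
    have hcard : ∑ v : Fin ℓ → Bool,
        ((Finset.univ.filter fun u => takeBits ℓ (C.enc u) = v).card : ℝ) = M := by
      have := Finset.card_eq_sum_card_fiberwise (s := (Finset.univ : Finset (Fin M)))
        (t := Finset.univ) (f := fun u => takeBits ℓ (C.enc u))
        fun _ _ => Finset.mem_coe.2 (Finset.mem_univ _)
      rw [Finset.card_univ, Fintype.card_fin] at this
      exact_mod_cast this.symm
    calc (θ * M - 2 ^ ℓ) / 2 = ∑ v : Fin ℓ → Bool,
          (θ * (Finset.univ.filter fun u => takeBits ℓ (C.enc u) = v).card - 1) / 2 := by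
          rw [← Finset.sum_div, Finset.sum_sub_distrib, ← Finset.mul_sum, hcard]
          simp
      _ ≤ _ := by
          refine Finset.sum_le_sum fun v _ => (hw v).trans_eq ?_
          refine Finset.sum_congr rfl fun u hu => ?_
          simp only [Finset.mem_filter, Finset.mem_univ, true_and] at hu
          rw [hu]

/-! ### The fixed-noise attack. -/

/-- Adding a fixed error word of weight `k` chosen well defeats every code with too many messages. -/
theorem exists_adversary_noise {n M k : ℕ} (C : DetCode n M) {p c : ℝ} (hk : (k : ℝ) ≤ p * n)
    (hkn : k ≤ n) (hM : 0 < M) (hc : c * M ≤ M - 2 ^ n / (n.choose k : ℝ)) :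
    ∃ A : CausalAdversary n p, ENNReal.ofReal c ≤ C.errorProb A := by
  set B : Finset (Finset (Fin n)) := Finset.powersetCard k Finset.univ with hB
  have hcard : B.card = n.choose k := by simp [hB]
  have hpos : 0 < n.choose k := Nat.choose_pos hkn
  have hne : B.Nonempty := Finset.card_pos.1 (hcard ▸ hpos)
  set noisy : Finset (Fin n) → (Fin n → Bool) → Fin n → Bool :=
    fun E x i => xor (x i) (decide (i ∈ E)) with hnoisy
  have hsum : ∑ E ∈ B, ∑ u, C.decProb (noisy E (C.enc u)) u ≤ 2 ^ n := by
    rw [Finset.sum_comm]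
    calc _ ≤ ∑ u, ∑ y, C.decProb y u := by
          refine Finset.sum_le_sum fun u _ => ?_
          -- For a fixed message, distinct error words give distinct received words, so each is
          -- counted at most once.
          have hinj : Set.InjOn (fun E => noisy E (C.enc u)) B := by
            intro E _ E' _ h
            ext i
            simpa [hnoisy] using congrFun h i
          rw [← Finset.sum_image (f := fun y => C.decProb y u) hinj]
          exact Finset.sum_le_sum_of_subset_of_nonneg (Finset.subset_univ _)
            fun y _ _ => C.decProb_nonneg y u
      _ = ∑ y : Fin n → Bool, (1 : ℝ) := by
          rw [Finset.sum_comm]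
          exact Finset.sum_congr rfl fun y _ => C.sum_decProb y
      _ = 2 ^ n := by simp
  obtain ⟨E, hE, hle⟩ : ∃ E ∈ B, ∑ u, C.decProb (noisy E (C.enc u)) u ≤
      2 ^ n / (n.choose k : ℝ) := by
    refine Finset.exists_le_of_sum_le hne (hsum.trans_eq ?_)
    rw [Finset.sum_const, hcard, nsmul_eq_mul]
    field_simp
  refine ⟨_, C.le_errorProb_ofFlips (fun _ i => decide (i ∈ E)) (fun _ _ _ _ => rfl)
    (fun _ => ?_) hM ?_⟩
  · have : E.card = k := (Finset.mem_powersetCard.1 hE).2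
    simpa [this] using hk
  · refine hc.trans ?_
    rw [Finset.sum_sub_distrib]
    simp only [Finset.sum_const, Finset.card_univ, Fintype.card_fin, nsmul_eq_mul, mul_one]
    exact sub_le_sub_left hle _

end DetCode

/-! ### Binomial coefficients and entropy. -/

/-- The binomial term `C(n,j) k ^ j (n - k) ^ (n - j)` is largest at `j = k`. -/
theorem choose_mul_pow_mul_pow_le {n k j : ℕ} (hk : k ≤ n) (hj : j ≤ n) :
    n.choose j * k ^ j * (n - k) ^ (n - j) ≤ n.choose k * k ^ k * (n - k) ^ (n - k) := by
  set a : ℕ → ℕ := fun j => n.choose j * k ^ j * (n - k) ^ (n - j) with ha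
  -- Consecutive terms share a factor, so they compare as `(n - k) * (i + 1)` and `(n - i) * k`:
  -- increasing for `i < k`, decreasing afterwards.
  have hsucc : ∀ i < n, a i * (i + 1) = n.choose i * k ^ i * (n - k) ^ (n - i - 1) *
        ((n - k) * (i + 1)) ∧
      a (i + 1) * (i + 1) = n.choose i * k ^ i * (n - k) ^ (n - i - 1) * ((n - i) * k) := by
    intro i hi
    constructor
    · have : (n - k) ^ (n - i) = (n - k) ^ (n - i - 1) * (n - k) := by
        rw [← pow_succ]
        congr 1
        omega
      simp only [ha, this]
      ring
    · have := Nat.choose_succ_right_eq n i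
      have h2 : n - (i + 1) = n - i - 1 := by omega
      calc a (i + 1) * (i + 1)
          = n.choose (i + 1) * (i + 1) * k ^ (i + 1) * (n - k) ^ (n - i - 1) := by
            simp only [ha, h2]
            ring
        _ = _ := by
            rw [this]
            ring
  change a j ≤ a k
  rcases le_total k j with h | h
  · induction j, h using Nat.le_induction with
    | base => exact le_rfl
    | succ i hi ih =>
      refine le_trans ?_ (ih (by omega))
      obtain ⟨h1, h2⟩ := hsucc i (by omega)
      refine Nat.le_of_mul_le_mul_right ?_ i.succ_pos
      rw [h1, h2]
      exact Nat.mul_le_mul_left _ (Nat.mul_le_mul (by omega) (by omega))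
  · induction h using Nat.decreasingInduction with
    | self => exact le_rfl
    | of_succ i hi ih =>
      refine le_trans ?_ (ih (by omega))
      obtain ⟨h1, h2⟩ := hsucc i (by omega)
      refine Nat.le_of_mul_le_mul_right ?_ i.succ_pos
      rw [h1, h2]
      exact Nat.mul_le_mul_left _ (Nat.mul_le_mul (by omega) (by omega))

theorem pow_self_le_mul_choose {n k : ℕ} (hk : k ≤ n) :
    n ^ n ≤ (n + 1) * (n.choose k * k ^ k * (n - k) ^ (n - k)) := by
  calc n ^ n = (k + (n - k)) ^ n := by rw [Nat.add_sub_cancel' hk]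
    _ = ∑ j ∈ Finset.range (n + 1), n.choose j * k ^ j * (n - k) ^ (n - j) := by
        rw [add_pow]
        exact Finset.sum_congr rfl fun j _ => by simp only [Nat.cast_id]; ring
    _ ≤ ∑ j ∈ Finset.range (n + 1), n.choose k * k ^ k * (n - k) ^ (n - k) :=
        Finset.sum_le_sum fun j hj => choose_mul_pow_mul_pow_le hk
          (Nat.lt_succ_iff.1 (Finset.mem_range.1 hj))
    _ = _ := by rw [Finset.sum_const, Finset.card_range, smul_eq_mul]

/-- The left side equals `n ^ n / (k ^ k * (n - k) ^ (n - k))`; the largest of the `n + 1` terms of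
`(k + (n - k)) ^ n` is at least their mean. -/
theorem exp_binEntropy_le_choose {n k : ℕ} (hk0 : 0 < k) (hkn : k < n) :
    Real.exp (n * Real.binEntropy (k / n)) ≤ (n + 1) * n.choose k := by
  have hk : (0 : ℝ) < k := by exact_mod_cast hk0
  have hn : (0 : ℝ) < n := by exact_mod_cast hk0.trans hkn
  have hnk : (0 : ℝ) < (n : ℝ) - k := sub_pos.2 (by exact_mod_cast hkn)
  have h := (Nat.cast_le (α := ℝ)).2 (pow_self_le_mul_choose hkn.le)
  push_cast [Nat.cast_sub hkn.le] at h
  have hlog : (n : ℝ) * Real.binEntropy (k / n) =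
      n * Real.log n - k * Real.log k - (n - k : ℕ) * Real.log (n - k) := by
    have h1 : (1 : ℝ) - k / n = (n - k) / n := by field_simp
    rw [Real.binEntropy, h1, Real.log_inv, Real.log_inv, Real.log_div hk.ne' hn.ne',
      Real.log_div hnk.ne' hn.ne', Nat.cast_sub hkn.le]
    field_simp
    ring
  rw [hlog, Real.exp_sub, Real.exp_sub, ← Real.log_pow, ← Real.log_pow, ← Real.log_pow,
    Real.exp_log (by positivity), Real.exp_log (by positivity), Real.exp_log (by positivity),
    div_div, div_le_iff₀ (by positivity)]
  linarith

/-! ### Asymptotics and the capacity bounds. -/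

/-- A smaller rate gives a negligible number of prefixes. -/
theorem eventually_two_pow_ceil_le {R' R θ : ℝ} (hR' : 0 ≤ R') (h : R' < R) (hθ : 0 < θ) :
    ∀ᶠ n : ℕ in atTop, (2 : ℝ) ^ ⌈R' * (n : ℝ)⌉₊ ≤ θ * (2 : ℝ) ^ (R * (n : ℝ)) := by
  have hlt : (2 : ℝ) ^ (R' - R) < 1 :=
    Real.rpow_lt_one_of_one_lt_of_neg one_lt_two (sub_neg.2 h)
  have ht := tendsto_pow_atTop_nhds_zero_of_lt_one (by positivity) hlt
  filter_upwards [ht.eventually_lt_const (half_pos hθ)] with n hn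
  calc (2 : ℝ) ^ ⌈R' * (n : ℝ)⌉₊ = (2 : ℝ) ^ ((⌈R' * (n : ℝ)⌉₊ : ℕ) : ℝ) :=
        (Real.rpow_natCast _ _).symm
    _ ≤ (2 : ℝ) ^ (R' * n + 1) :=
        Real.rpow_le_rpow_of_exponent_le one_le_two (Nat.ceil_lt_add_one (by positivity)).le
    _ = 2 * ((2 : ℝ) ^ (R' - R)) ^ n * (2 : ℝ) ^ (R * (n : ℝ)) := by
        rw [← Real.rpow_mul_natCast zero_le_two, mul_assoc, ← Real.rpow_add two_pos,
          Real.rpow_add_one two_ne_zero, mul_comm]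
        ring_nf
    _ ≤ θ * (2 : ℝ) ^ (R * (n : ℝ)) := by
        refine mul_le_mul_of_nonneg_right ?_ (by positivity)
        linarith

theorem numMessages_pos (n : ℕ) (R : ℝ) : 0 < ⌈(2 : ℝ) ^ (R * (n : ℝ))⌉₊ :=
  Nat.ceil_pos.2 (by positivity)

/-- Above the rate `(1 - 4 p)⁺` the error probability is bounded away from zero. -/
theorem exists_error_bound {p R : ℝ} (hp : 0 ≤ p) (hR : max (1 - 4 * p) 0 < R) :
    ∃ c : ℝ, 0 < c ∧ ∀ᶠ n : ℕ in atTop, ∀ C : DetCodeOfRate n R,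
      ∃ A : CausalAdversary n p, ENNReal.ofReal c ≤ C.errorProb A := by
  obtain ⟨R', h1, h2⟩ := exists_between hR
  obtain ⟨h3, h4⟩ := max_lt_iff.1 h1
  suffices h : ∃ θ : ℝ, 0 < θ ∧ ∀ᶠ n : ℕ in atTop, ∃ D : ℝ, 0 < D ∧
      (∀ d : ℕ, (d : ℝ) < D → (((d + 1) / 2 : ℕ) : ℝ) ≤ p * n) ∧
      ((n - ⌈R' * (n : ℝ)⌉₊ : ℕ) : ℝ) ≤ 2 * (1 - θ) * D by
    obtain ⟨θ, hθ, hev⟩ := h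
    -- Once `2 ^ ℓ ≤ (θ / 2) * M`, the bound `(θ * M - 2 ^ ℓ) / 2` is at least `θ * M / 4`.
    refine ⟨θ / 4, by positivity, ?_⟩
    filter_upwards [hev, eventually_two_pow_ceil_le h4.le h2 (half_pos hθ)] with n hn hpow C
    obtain ⟨D, hD, hbudget, hℓ⟩ := hn
    refine C.exists_adversary_push hp (numMessages_pos n R) hD hbudget hℓ ?_
    have hM := Nat.le_ceil ((2 : ℝ) ^ (R * (n : ℝ)))
    have := hpow.trans (mul_le_mul_of_nonneg_left hM (half_pos hθ).le)
    linarith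
  have hsub : ∀ n : ℕ, ((n - ⌈R' * (n : ℝ)⌉₊ : ℕ) : ℝ) ≤ max 0 (1 - R') * n := by
    intro n
    rcases le_total n ⌈R' * (n : ℝ)⌉₊ with h | h
    · rw [Nat.sub_eq_zero_of_le h, Nat.cast_zero]
      positivity
    · rw [Nat.cast_sub h]
      have := Nat.le_ceil (R' * (n : ℝ))
      have := mul_le_mul_of_nonneg_right (le_max_right 0 (1 - R')) n.cast_nonneg
      linarith
  rcases hp.eq_or_lt with rfl | hp
  -- Here `R' > 1`, so the prefix is the whole word, and `D = 1` admits only distance 0.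
  · refine ⟨1 / 2, by norm_num, Eventually.of_forall fun n => ⟨1, one_pos, ?_, ?_⟩⟩
    · intro d hd
      have : d = 0 := by
        have : d < 1 := by exact_mod_cast hd
        omega
      simp [this]
    · refine (hsub n).trans ?_
      rw [max_eq_left (by linarith)]
      norm_num
  · set κ := max 0 (1 - R') with hκ
    have hκ4 : κ < 4 * p := max_lt (by positivity) (by linarith)
    -- This `θ` makes `4 * p * (1 - θ)` the midpoint of `κ` and `4 * p`.
    refine ⟨(4 * p - κ) / (8 * p), div_pos (by linarith) (by positivity), ?_⟩
    have ht1 : Tendsto (fun n : ℕ => (4 * p - κ) * (n : ℝ)) atTop atTop :=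
      tendsto_natCast_atTop_atTop.const_mul_atTop (by linarith)
    have ht2 : Tendsto (fun n : ℕ => 2 * p * (n : ℝ)) atTop atTop :=
      tendsto_natCast_atTop_atTop.const_mul_atTop (by positivity)
    filter_upwards [ht1.eventually_ge_atTop 4, ht2.eventually_gt_atTop 1] with n hn1 hn2
    -- The `- 1` pays for rounding up half of an odd distance.
    refine ⟨2 * p * n - 1, by linarith, ?_, (hsub n).trans ?_⟩
    · intro d hd
      have : (((d + 1) / 2 : ℕ) : ℝ) ≤ ((d + 1 : ℕ) : ℝ) / 2 := Nat.cast_div_le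
      push_cast at this
      linarith
    · have hθ : 2 * (1 - (4 * p - κ) / (8 * p)) * (2 * p * n - 1) =
          (κ + 4 * p) * n / 2 - (4 * p + κ) / (4 * p) := by
        field_simp
        ring
      have : (4 * p + κ) / (4 * p) ≤ 2 := by
        rw [div_le_iff₀ (by positivity)]
        linarith
      rw [hθ]
      linarith

theorem not_weaklyAchievable {p R δ c : ℝ} (hδ : 0 < δ) (hc : 0 < c)
    (h : ∀ᶠ n : ℕ in atTop, ∀ C : DetCodeOfRate n (R - δ),
      ∃ A : CausalAdversary n p, ENNReal.ofReal c ≤ C.errorProb A) :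
    ¬ WeaklyAchievable p R := by
  intro hR
  obtain ⟨n, h1, C, hC⟩ := (h.and (hR (c / 2) (half_pos hc) δ hδ)).exists
  obtain ⟨A, hA⟩ := h1 C
  have := (ENNReal.ofReal_le_ofReal_iff (half_pos hc).le).1 (hA.trans (hC A))
  linarith

theorem WeaklyAchievable.le_max {p R : ℝ} (hp : 0 ≤ p) (hR : WeaklyAchievable p R) :
    R ≤ max (1 - 4 * p) 0 := by
  by_contra! hlt
  obtain ⟨c, hc, h⟩ := exists_error_bound (R := R - (R - max (1 - 4 * p) 0) / 2) hp (by linarith)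
  exact not_weaklyAchievable (by linarith) hc h hR

theorem WeaklyAchievable.le_one_sub_entropy {p R : ℝ} (hp0 : 0 < p) (hp1 : p < 1)
    (hR : WeaklyAchievable p R) : R ≤ 1 - binaryEntropyBits p := by
  by_contra! hlt
  -- One `δ` is lost in the rate, one in replacing `p` by `k / n` in the entropy, and one absorbs
  -- the factor `n + 1`.
  set δ := (R - (1 - binaryEntropyBits p)) / 3 with hδ
  have hδ0 : 0 < δ := by
    rw [hδ]
    linarith
  have hlog2 : 0 < Real.log 2 := Real.log_pos one_lt_two
  refine not_weaklyAchievable hδ0 (half_pos one_pos) ?_ hR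
  have hfloor : Tendsto (fun n : ℕ => ((⌊p * (n : ℝ)⌋₊ : ℕ) : ℝ) / n) atTop (nhds p) :=
    (tendsto_nat_floor_mul_div_atTop hp0.le).comp tendsto_natCast_atTop_atTop
  have hent := (Real.binEntropy_continuous.tendsto p).comp hfloor
  have hdecay : Tendsto (fun n : ℕ => ((n : ℝ) + 1) * ((2 : ℝ) ^ (-δ)) ^ n) atTop (nhds 0) := by
    have hlt : (2 : ℝ) ^ (-δ) < 1 :=
      Real.rpow_lt_one_of_one_lt_of_neg one_lt_two (neg_neg_of_pos hδ0)
    have h1 := tendsto_self_mul_const_pow_of_lt_one (by positivity) hlt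
    have h2 := tendsto_pow_atTop_nhds_zero_of_lt_one (by positivity) hlt
    simpa [add_mul] using h1.add h2
  have hent_lt : (binaryEntropyBits p - δ) * Real.log 2 < Real.binEntropy p := by
    have : binaryEntropyBits p * Real.log 2 = Real.binEntropy p :=
      div_mul_cancel₀ _ hlog2.ne'
    nlinarith
  filter_upwards [hfloor.eventually_const_lt hp0, hfloor.eventually_lt_const hp1,
    hent.eventually_const_lt hent_lt, hdecay.eventually_lt_const (half_pos one_pos),
    eventually_gt_atTop 0] with n hk0 hk1 hH hdec hn C
  have hn' : (0 : ℝ) < n := by exact_mod_cast hn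
  set k := ⌊p * (n : ℝ)⌋₊ with hk
  have hkn : k < n := by exact_mod_cast (div_lt_one hn').1 hk1
  have hkpos : 0 < k := by
    by_contra h0
    simp [Nat.eq_zero_of_not_pos h0] at hk0
  refine C.exists_adversary_noise (Nat.floor_le (by positivity)) hkn.le (numMessages_pos n _) ?_
  set M := ⌈(2 : ℝ) ^ ((R - δ) * (n : ℝ))⌉₊ with hM
  have hMle : (2 : ℝ) ^ ((R - δ) * (n : ℝ)) ≤ M := Nat.le_ceil _
  have hchoose : (2 : ℝ) ^ ((binaryEntropyBits p - δ) * n) ≤ (n + 1) * n.choose k := by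
    refine le_trans ?_ (exp_binEntropy_le_choose hkpos hkn)
    rw [Real.rpow_def_of_pos two_pos]
    refine Real.exp_le_exp.2 ?_
    have := mul_le_mul_of_nonneg_left hH.le hn'.le
    simp only [Function.comp_apply] at this
    linarith
  have hprod : (2 : ℝ) ^ n ≤ M / 2 * n.choose k := by
    have hcpos : (0 : ℝ) < n.choose k := by exact_mod_cast Nat.choose_pos hkn.le
    calc (2 : ℝ) ^ n = (2 : ℝ) ^ ((R - δ) * (n : ℝ)) * (2 : ℝ) ^ ((binaryEntropyBits p - δ) * n) *
          ((2 : ℝ) ^ (-δ)) ^ n := by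
          rw [← Real.rpow_mul_natCast zero_le_two, ← Real.rpow_add two_pos,
            ← Real.rpow_add two_pos, ← Real.rpow_natCast]
          congr 1
          rw [hδ]
          ring
      _ ≤ M * ((n + 1) * n.choose k) * ((2 : ℝ) ^ (-δ)) ^ n := by gcongr
      _ = M * n.choose k * ((n + 1) * ((2 : ℝ) ^ (-δ)) ^ n) := by ring
      _ ≤ M * n.choose k * (1 / 2) := by gcongr
      _ = _ := by ring
  have := div_le_of_le_mul₀ (Nat.cast_nonneg _) (by positivity) hprod
  linarith

theorem StronglyAchievable.weaklyAchievable {p R : ℝ} (h : StronglyAchievable p R) :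
    WeaklyAchievable p R := by
  intro ε hε δ hδ
  obtain ⟨α, hα, hev⟩ := h δ hδ
  have ht : Tendsto (fun n : ℕ => Real.exp (-α * (n : ℝ))) atTop (nhds 0) :=
    Real.tendsto_exp_atBot.comp
      (tendsto_natCast_atTop_atTop.const_mul_atTop_of_neg (neg_neg_of_pos hα))
  filter_upwards [hev, ht.eventually_le_const hε] with n ⟨C, hC⟩ hn
  exact ⟨C, fun A => (hC A).trans (ENNReal.ofReal_le_ofReal hn)⟩

theorem binaryEntropyBits_le_one (p : ℝ) : binaryEntropyBits p ≤ 1 :=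
  (div_le_one (Real.log_pos one_lt_two)).2 Real.binEntropy_le_log_two

theorem WeaklyAchievable.le_capacity_bound {p R : ℝ} (hp0 : 0 ≤ p) (hR : WeaklyAchievable p R) :
    R ≤ min (1 - binaryEntropyBits p) (max (1 - 4 * p) 0) := by
  have hmax := hR.le_max hp0
  refine le_min ?_ hmax
  -- The noise attack needs `0 < k < n`. At `p = 0` both bounds equal 1, and for `p ≥ 1` the bound 0
  -- is already the stronger.
  rcases hp0.eq_or_lt with rfl | hpos
  · simpa [binaryEntropyBits] using hmax
  · rcases lt_or_ge p 1 with hp1 | hp1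
    · exact hR.le_one_sub_entropy hpos hp1
    · rw [max_eq_right (by linarith)] at hmax
      linarith [binaryEntropyBits_le_one p]

theorem theorem1 (p : ℝ) (hp0 : 0 ≤ p) (hp1 : p ≤ 1) :
    strongCapacity p ≤ weakCapacity p ∧
    weakCapacity p ≤ ((min (1 - binaryEntropyBits p) (max (1 - 4 * p) 0) : ℝ) : EReal) ∧
    (∀ R : ℝ, max (1 - 4 * p) 0 < R →
      ∃ c : ℝ, 0 < c ∧ ∀ᶠ n : ℕ in atTop, ∀ C : DetCodeOfRate n R,
        ∃ A : CausalAdversary n p, ENNReal.ofReal c ≤ C.errorProb A) := by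
  refine ⟨?_, ?_, fun R hR => exists_error_bound hp0 hR⟩
  · exact iSup_mono fun R => iSup_mono' fun h => ⟨⟨h.1, h.2.weaklyAchievable⟩, le_rfl⟩
  · exact iSup₂_le fun R h => EReal.coe_le_coe_iff.2 (h.2.le_capacity_bound hp0)
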